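/- Let $G$ be a finite group with identity $e$, and let $\mathrm{Irr}(G)$ be its set of irreducible complex characters. A supercharacter theory of $G$ is a pair $(\mathcal X,\mathcal K)$, where $\mathcal X$ is a partition of $\mathrm{Irr}(G)$ and $\mathcal K$ is a partition of $G$ into unions of conjugacy classes, such that $\{e\}\in\mathcal K$, the singleton of the trivial character belongs to $\mathcal X$, $|\mathcal X|=|\mathcal K|$, and for every $X\in\mathcal X$ the supercharacter $\sigma_X=\sum_{\chi\in X}\chi(e)\chi$ is constant on every superclass $K\in\mathcal K$. Its supercharacter table is the matrix with rows indexed by $\mathcal X$, columns indexed by $\mathcal K$, and $(X,K)$ entry the value of $\sigma_X$ on $K$. Its associated algebra is the linear span in $\mathbb C G$ of the elements $\widehat K=\sum_{g\in K}g$, $K\in\mathcal K$; it is closed under the ordinary product of $\mathbb C G$ and under the Hadamard product $\left(\sum_g a_g g\right)\circ\left(\sum_g b_g g\right)=\sum_g a_gb_g\,g$. Let $A$ be a supercharacter theory of a finite group $G$ and $B$ a supercharacter theory of a finite group $H$, and denote their associated algebras by the same letters. An isomorphism of supercharacter theories is a bijective $\mathbb C$-linear map $\phi:A\to B$ with $\phi(xy)=\phi(x)\phi(y)$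 and $\phi(x\circ y)=\phi(x)\circ\phi(y)$ for all $x,y\in A$. **Theorem.** There is an isomorphism of supercharacter theories $\phi:A\to B$ if and only if the supercharacter tables of $A$ and $B$ are identical up to reordering of rows and columns; that is, if and only if there are bijections $r:\mathcal X_A\to\mathcal X_B$ and $c:\mathcal K_A\to\mathcal K_B$ such that, for all $X\in\mathcal X_A$ and $K\in\mathcal K_A$, the $(X,K)$ entry of the table of $A$ equals the $(r(X),c(K))$ entry of the table of $B$. -/

import Mathlib

open scoped MonoidAlgebra

universe u v

noncomputable section

/-- `χ` is an irreducible complex character of `G`: the trace function of an irreducible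
finite-dimensional complex representation. (Every such representation is isomorphic to one
on a space living in `Type`.) -/
def IsIrrChar (G : Type u) [Group G] (χ : G → ℂ) : Prop :=
  ∃ (V : Type) (_ : AddCommGroup V) (_ : Module ℂ V) (_ : FiniteDimensional ℂ V)
    (ρ : Representation ℂ G V), ρ.IsIrreducible ∧ ρ.character = χ

/-- The set `Irr(G)` of irreducible complex characters of `G`, as a type. -/
abbrev Irr (G : Type u) [Group G] : Type u := {χ : G → ℂ // IsIrrChar G χ}

/-- The Hadamard (coefficientwise) product on the group algebra `ℂ[G]`. -/
def hadamardProd {G : Type u} (x y : ℂ[G]) : ℂ[G] :=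
  .ofCoeff (Finsupp.zipWith (fun a b : ℂ => a * b) (mul_zero 0) x.coeff y.coeff)

/-- The sum `∑_{g ∈ K} g`, in the group algebra, of the elements of a subset `K` of `G`. -/
def setSum {G : Type u} [Finite G] (K : Set G) : ℂ[G] :=
  ∑ g ∈ K.toFinite.toFinset, MonoidAlgebra.single g (1 : ℂ)

theorem coeff_hadamardProd {G : Type u} (x y : ℂ[G]) (g : G) :
    (hadamardProd x y).coeff g = x.coeff g * y.coeff g := by
  simp [hadamardProd]

open Classical in
theorem coeff_setSum {G : Type u} [Finite G] (K : Set G) (g : G) :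
    (setSum K).coeff g = if g ∈ K then 1 else 0 := by
  simp [setSum, MonoidAlgebra.coeff_sum, Finsupp.single_apply, Finsupp.finsetSum_apply]

section Characters

variable {G : Type u} [Group G]

/-- The character of the trivial representation. -/
def trivIrr (G : Type u) [Group G] : Irr G :=
  ⟨fun _ => 1, ℂ, inferInstance, inferInstance, inferInstance, Representation.trivial ℂ G ℂ, by
    have key : ∀ σ : Subrepresentation (Representation.trivial ℂ G ℂ),
        σ = ⊥ ∨ σ = ⊤ := fun σ =>
      (eq_bot_or_eq_top σ.toSubmodule).imp
        (fun h => Subrepresentation.toSubmodule_injective h)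
        (fun h => Subrepresentation.toSubmodule_injective h)
    have hne : (⊥ : Subrepresentation (Representation.trivial ℂ G ℂ)) ≠ ⊤ :=
      fun h => bot_ne_top (α := Submodule ℂ ℂ)
        (congrArg Subrepresentation.toSubmodule h)
    exact { exists_pair_ne := ⟨_, _, hne⟩, eq_bot_or_eq_top := key }, by
    funext g
    simp [Representation.character]⟩

theorem IsIrrChar.conj {χ : G → ℂ} (hχ : IsIrrChar G χ) (g h : G) :
    χ (h * g * h⁻¹) = χ g := by
  obtain ⟨V, _, _, _, ρ, -, rfl⟩ := hχ
  exact Representation.char_conj ρ g h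

theorem IsIrrChar.exists_nat {χ : G → ℂ} (hχ : IsIrrChar G χ) :
    ∃ n : ℕ, 0 < n ∧ χ 1 = n := by
  obtain ⟨V, _, _, _, ρ, hρ, rfl⟩ := hχ
  refine ⟨Module.finrank ℂ V, ?_, Representation.char_one ρ⟩
  by_contra h0
  have h0 : Module.finrank ℂ V = 0 := by omega
  have : Subsingleton V := Module.finrank_zero_iff.1 h0
  exact bot_ne_top (α := Subrepresentation ρ)
    (Subrepresentation.toSubmodule_injective (Subsingleton.elim _ _))

theorem exists_scalar [Fintype G] {V : Type} [AddCommGroup V] [Module ℂ V]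
    [FiniteDimensional ℂ V] (τ : Representation ℂ G V) (hτ : τ.IsIrreducible) (χ : G → ℂ)
    (hχ : ∀ g h, χ (h * g * h⁻¹) = χ g) :
    ∃ c : ℂ, (∑ h, χ h • τ h⁻¹) = c • (1 : Module.End ℂ V) := by
  have hcomm : ∀ g : G, (∑ h, χ h • τ h⁻¹) ∘ₗ τ g = τ g ∘ₗ (∑ h, χ h • τ h⁻¹) := by
    intro g
    change (∑ h, χ h • τ h⁻¹) * τ g = τ g * (∑ h, χ h • τ h⁻¹)
    rw [Finset.sum_mul, Finset.mul_sum]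
    refine Fintype.sum_equiv (MulAut.conj g⁻¹).toEquiv _ _ fun h => ?_
    have h1 : χ (g⁻¹ * h * g) = χ h := by simpa using hχ h g⁻¹
    simp [← map_mul, mul_assoc, ← h1]
  let f : Representation.IntertwiningMap τ τ := ⟨∑ h, χ h • τ h⁻¹, hcomm⟩
  obtain ⟨c, hc⟩ :=
    (Representation.IsIrreducible.algebraMap_intertwiningMap_bijective_of_isAlgClosed
      (ρ := τ)).2 f
  refine ⟨c, ?_⟩
  have := congrArg (fun F => F.toLinearMap) hc
  exact this.symm

open Classical in
/-- Convolution of irreducible characters. -/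
theorem irr_convolution [Fintype G] (χ ψ : Irr G) (g : G) :
    ∑ h, χ.1 h * ψ.1 (h⁻¹ * g) = if χ = ψ then (Nat.card G : ℂ) / χ.1 1 * χ.1 g else 0 := by
  have hcard : (Nat.card G : ℂ) ≠ 0 := by exact_mod_cast Nat.card_pos.ne'
  let _ : Invertible (Nat.card G : ℂ) := invertibleOfNonzero hcard
  obtain ⟨n, hn, hψ1⟩ := ψ.2.exists_nat
  have hn' : (n : ℂ) ≠ 0 := by exact_mod_cast hn.ne'
  obtain ⟨χ, hχ⟩ := χ
  obtain ⟨ψ, hψ⟩ := ψ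
  have hclass := hχ.conj
  obtain ⟨W, _, _, _, τ, hτ, rfl⟩ := hψ
  obtain ⟨c, hc⟩ := exists_scalar τ hτ χ hclass
  have hconv : ∀ g, ∑ h, χ h * τ.character (h⁻¹ * g) = c * τ.character g := by
    intro g
    have := congrArg (fun T => LinearMap.trace ℂ W (T * τ g)) hc
    simpa [Finset.sum_mul, Representation.character, map_mul, ← Representation.char_mul_comm]
      using this
  have h1 := hconv 1
  simp only [mul_one] at h1
  rw [hconv]
  change τ.character 1 = n at hψ1
  change _ = ite _ (Nat.card G / χ 1 * χ g) 0
  rw [hψ1] at h1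
  split_ifs with h
  · obtain rfl : χ = τ.character := congrArg Subtype.val h
    have ho := Representation.char_orthonormal τ τ
    rw [if_pos ⟨Representation.Equiv.refl τ⟩, h1] at ho
    rw [hψ1]
    field_simp at ho ⊢
    rw [ho]
  · obtain ⟨V, _, _, _, ρ, hρ, rfl⟩ := hχ
    have ho := Representation.char_orthonormal ρ τ
    rw [if_neg (fun ⟨e⟩ => h (Subtype.ext (Representation.char_iso e).symm)), h1] at ho
    have : c = 0 := by
      simpa [hcard, hn'] using ho
    simp [this]

/-- The element `∑_g f(g) g` of the group algebra. -/
def funToAlg [Finite G] : (G → ℂ) →ₗ[ℂ] ℂ[G] where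
  toFun f := .ofCoeff (Finsupp.equivFunOnFinite.symm f)
  map_add' f g := by ext; simp
  map_smul' c f := by ext; simp

theorem coeff_funToAlg {G : Type u} [Finite G] (f : G → ℂ) (g : G) : (funToAlg f).coeff g = f g := rfl

theorem coeff_funToAlg_mul [Fintype G] (f f' : G → ℂ) (g : G) :
    (funToAlg f * funToAlg f').coeff g = ∑ h, f h * f' (h⁻¹ * g) := by
  rw [MonoidAlgebra.coeff_mul_apply_left, Finsupp.sum_fintype]
  · rfl
  · simp

/-- The element `(χ(1)/|G|) ∑_g χ(g) g`: the central idempotent of the conjugate of `χ`. -/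
def irrElt [Finite G] (χ : Irr G) : ℂ[G] :=
  (χ.1 1 / Nat.card G) • funToAlg χ.1

open Classical in
theorem irrElt_mul [Finite G] (χ ψ : Irr G) :
    irrElt χ * irrElt ψ = if χ = ψ then irrElt χ else 0 := by
  cases nonempty_fintype G
  have hcard : (Nat.card G : ℂ) ≠ 0 := by exact_mod_cast Nat.card_pos.ne'
  obtain ⟨n, hn, hχ1⟩ := χ.2.exists_nat
  have hn' : (n : ℂ) ≠ 0 := by exact_mod_cast hn.ne'
  ext g
  rw [irrElt, irrElt, smul_mul_smul_comm, MonoidAlgebra.coeff_smul_apply, coeff_funToAlg_mul,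
    irr_convolution]
  split_ifs with h
  · subst h
    rw [MonoidAlgebra.coeff_smul_apply, coeff_funToAlg, hχ1, smul_eq_mul, smul_eq_mul]
    field_simp
  · simp

theorem irrElt_ne_zero [Finite G] (χ : Irr G) : irrElt χ ≠ 0 := by
  have hcard : (Nat.card G : ℂ) ≠ 0 := by exact_mod_cast Nat.card_pos.ne'
  obtain ⟨n, hn, hχ1⟩ := χ.2.exists_nat
  have hn' : (n : ℂ) ≠ 0 := by exact_mod_cast hn.ne'
  intro h
  have := congrArg (fun x => x.coeff 1) h
  simp only [irrElt, MonoidAlgebra.coeff_smul_apply, coeff_funToAlg, hχ1] at this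
  exact mul_ne_zero (div_ne_zero hn' hcard) hn' this

theorem linearIndependent_of_orthogonal {R ι : Type*} [DecidableEq ι] [Ring R] [Algebra ℂ R] (e : ι → R)
    (he : ∀ i j, e i * e j = if i = j then e i else 0) (h0 : ∀ i, e i ≠ 0) :
    LinearIndependent ℂ e := by
  rw [linearIndependent_iff']
  intro s a hs i hi
  have := congrArg (fun x => x * e i) hs
  simp only [Finset.sum_mul, smul_mul_assoc, he, smul_ite, smul_zero, zero_mul,
    Finset.sum_ite_eq', hi, if_true] at this
  exact (smul_eq_zero.1 this).resolve_right (h0 i)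

instance finiteDimensional_groupAlgebra [Finite G] : FiniteDimensional ℂ ℂ[G] :=
  Module.Finite.of_surjective funToAlg fun x => ⟨x.coeff, by ext; rfl⟩

open Classical in
instance finite_irr [Finite G] : Finite (Irr G) :=
  (linearIndependent_of_orthogonal irrElt irrElt_mul irrElt_ne_zero).finite

/-- The class function `σ_X = ∑_{χ ∈ X} χ(1) χ` attached to a set `X` of irreducible
characters. -/
def sigmaChar [Finite G] (X : Set (Irr G)) (g : G) : ℂ :=
  ∑ χ ∈ X.toFinite.toFinset, χ.1 1 * χ.1 g

end Characters

/-- A supercharacter theory `(𝒳, 𝒦)` of a finite group `G`. The partition `𝒦` of the set of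
conjugacy classes is recorded as the partition of `G` into the unions of its blocks. -/
structure SupercharacterTheory (G : Type u) [Group G] [Finite G] where
  /-- The partition `𝒳` of `Irr(G)`. -/
  charBlocks : Set (Set (Irr G))
  /-- The partition `𝒦`, whose members are the superclasses. -/
  superclasses : Set (Set G)
  isPartition_charBlocks : Setoid.IsPartition charBlocks
  isPartition_superclasses : Setoid.IsPartition superclasses
  conj_mem : ∀ K ∈ superclasses, ∀ g ∈ K, ∀ h : G, h * g * h⁻¹ ∈ K
  one_mem : {1} ∈ superclasses
  triv_mem : {trivIrr G} ∈ charBlocks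
  card_eq : Nat.card superclasses = Nat.card charBlocks
  sigma_const : ∀ X ∈ charBlocks, ∀ K ∈ superclasses, ∀ g ∈ K, ∀ h ∈ K,
    sigmaChar X g = sigmaChar X h

namespace SupercharacterTheory

section

variable {G : Type u} [Group G] [Finite G] (A : SupercharacterTheory G)

/-- The linear subspace of `ℂ[G]` spanned by the superclass sums. -/
def space : Submodule ℂ ℂ[G] :=
  Submodule.span ℂ (Set.range fun K : A.superclasses => setSum K.1)

theorem nonempty_superclass (K : A.superclasses) : K.1.Nonempty :=
  Setoid.nonempty_of_mem_partition A.isPartition_superclasses K.2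

/-- The supercharacter table: rows are indexed by the blocks `X` of characters (equivalently by the
supercharacters `σ_X`), columns by the superclasses `K`, and the `(X, K)` entry is the constant
value of `σ_X` on `K`. -/
def table : Matrix A.charBlocks A.superclasses ℂ :=
  fun X K => sigmaChar X.1 (A.nonempty_superclass K).some

theorem table_eq (X : A.charBlocks) (K : A.superclasses) {g : G} (hg : g ∈ K.1) :
    A.table X K = sigmaChar X.1 g :=
  A.sigma_const X.1 X.2 K.1 K.2 _ (A.nonempty_superclass K).some_mem _ hg

theorem mem_space_of_const (x : ℂ[G])
    (hx : ∀ K ∈ A.superclasses, ∀ g ∈ K, ∀ h ∈ K, x.coeff g = x.coeff h) : x ∈ A.space := by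
  classical
  cases nonempty_fintype A.superclasses
  have : x = ∑ K : A.superclasses,
      x.coeff (A.nonempty_superclass K).some • setSum K.1 := by
    ext g
    obtain ⟨K, ⟨hK, hgK⟩, huniq⟩ := A.isPartition_superclasses.2 g
    rw [MonoidAlgebra.coeff_sum, Finsupp.finsetSum_apply, Finset.sum_eq_single ⟨K, hK⟩]
    · rw [MonoidAlgebra.coeff_smul_apply, coeff_setSum, if_pos hgK, smul_eq_mul, mul_one]
      exact hx K hK _ hgK _ (A.nonempty_superclass ⟨K, hK⟩).some_mem
    · intro L _ hL
      rw [MonoidAlgebra.coeff_smul_apply, coeff_setSum, if_neg, smul_zero]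
      exact fun h => hL (Subtype.ext (huniq L.1 ⟨L.2, h⟩))
    · simp
  rw [this]
  exact Submodule.sum_mem _ fun K _ =>
    Submodule.smul_mem _ _ (Submodule.subset_span ⟨K, rfl⟩)

theorem const_of_mem_space {x : ℂ[G]} (hx : x ∈ A.space) :
    ∀ K ∈ A.superclasses, ∀ g ∈ K, ∀ h ∈ K, x.coeff g = x.coeff h := by
  intro K hK g hg h hh
  induction hx using Submodule.span_induction with
  | mem x hx =>
    classical
    obtain ⟨L, rfl⟩ := hx
    simp only [coeff_setSum]
    have : ∀ k ∈ K, (k ∈ L.1 ↔ K = L.1) := fun k hk =>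
      ⟨fun h => (A.isPartition_superclasses.2 k).unique ⟨hK, hk⟩ ⟨L.2, h⟩, fun h => h ▸ hk⟩
    simp only [this g hg, this h hh]
  | zero => rfl
  | add x y _ _ hx hy => simp [hx, hy]
  | smul c x _ hx => simp [hx]

theorem hadamard_mem {x y : ℂ[G]} (hx : x ∈ A.space) (hy : y ∈ A.space) :
    hadamardProd x y ∈ A.space :=
  A.mem_space_of_const _ fun K hK g hg h hh => by
    rw [coeff_hadamardProd, coeff_hadamardProd, A.const_of_mem_space hx K hK g hg h hh,
      A.const_of_mem_space hy K hK g hg h hh]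

/-- The element `(1/|G|) ∑_g σ_X(g) g`. -/
def blockElt (X : A.charBlocks) : ℂ[G] :=
  ∑ χ ∈ X.1.toFinite.toFinset, irrElt χ

theorem blockElt_mem (X : A.charBlocks) : A.blockElt X ∈ A.space := by
  have h : ∀ g, (A.blockElt X).coeff g = (Nat.card G : ℂ)⁻¹ * sigmaChar X.1 g := by
    intro g
    simp only [blockElt, sigmaChar, MonoidAlgebra.coeff_sum, Finsupp.finsetSum_apply, irrElt,
      MonoidAlgebra.coeff_smul_apply, coeff_funToAlg, Finset.mul_sum, smul_eq_mul]
    exact Finset.sum_congr rfl fun χ _ => by ring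
  exact A.mem_space_of_const _ fun K hK g hg k hk => by
    rw [h, h, A.sigma_const X.1 X.2 K hK g hg k hk]

open Classical in
theorem irrElt_mul_blockElt (χ : Irr G) (X : A.charBlocks) :
    irrElt χ * A.blockElt X = if χ ∈ X.1 then irrElt χ else 0 := by
  simp [blockElt, Finset.mul_sum, irrElt_mul]

open Classical in
theorem blockElt_mul (X Y : A.charBlocks) :
    A.blockElt X * A.blockElt Y = if X = Y then A.blockElt X else 0 := by
  conv_lhs => rw [blockElt, Finset.sum_mul]
  simp only [irrElt_mul_blockElt]
  have : ∀ χ ∈ X.1, (χ ∈ Y.1 ↔ X = Y) := fun χ hχ =>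
    ⟨fun h => Subtype.ext
      ((A.isPartition_charBlocks.2 χ).unique ⟨X.2, hχ⟩ ⟨Y.2, h⟩), fun h => h ▸ hχ⟩
  rw [Finset.sum_congr rfl (g := fun χ => if X = Y then irrElt χ else 0)]
  · split_ifs <;> simp [blockElt]
  · intro χ hχ
    simp only [this χ (by simpa using hχ)]

theorem blockElt_ne_zero (X : A.charBlocks) : A.blockElt X ≠ 0 := by
  classical
  obtain ⟨χ, hχ⟩ := Setoid.nonempty_of_mem_partition A.isPartition_charBlocks X.2
  intro h
  have := A.irrElt_mul_blockElt χ X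
  rw [h, if_pos hχ, mul_zero] at this
  exact irrElt_ne_zero χ this.symm

theorem span_blockElt : Submodule.span ℂ (Set.range A.blockElt) = A.space := by
  classical
  cases nonempty_fintype A.superclasses
  cases nonempty_fintype A.charBlocks
  refine Submodule.eq_of_le_of_finrank_le
    (Submodule.span_le.2 (Set.range_subset_iff.2 A.blockElt_mem)) ?_
  rw [finrank_span_eq_card
    (linearIndependent_of_orthogonal A.blockElt A.blockElt_mul A.blockElt_ne_zero),
    ← Nat.card_eq_fintype_card, ← A.card_eq, Nat.card_eq_fintype_card]
  exact finrank_range_le_card _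

theorem mul_mem {x y : ℂ[G]} (hx : x ∈ A.space) (hy : y ∈ A.space) : x * y ∈ A.space := by
  classical
  rw [← span_blockElt] at hx hy
  induction hx, hy using Submodule.span_induction₂ with
  | mem_mem x y hx hy =>
    obtain ⟨X, rfl⟩ := hx
    obtain ⟨Y, rfl⟩ := hy
    rw [A.blockElt_mul]
    split_ifs
    · exact A.blockElt_mem X
    · exact A.space.zero_mem
  | zero_left y _ => rw [zero_mul]; exact A.space.zero_mem
  | zero_right x _ => rw [mul_zero]; exact A.space.zero_mem
  | add_left x y z _ _ _ h1 h2 => rw [add_mul]; exact A.space.add_mem h1 h2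
  | add_right x y z _ _ _ h1 h2 => rw [mul_add]; exact A.space.add_mem h1 h2
  | smul_left r x y _ _ h => rw [smul_mul_assoc]; exact A.space.smul_mem _ h
  | smul_right r x y _ _ h => rw [mul_smul_comm]; exact A.space.smul_mem _ h

end

section

variable {G : Type u} {H : Type v} [Group G] [Finite G] [Group H] [Finite H]

/-- A linear map between the algebras of two supercharacter theories is a homomorphism of
supercharacter theories if it preserves the ordinary product and the Hadamard product. -/
structure IsHom (A : SupercharacterTheory G) (B : SupercharacterTheory H)
    (φ : A.space →ₗ[ℂ] B.space) : Prop where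
  map_mul : ∀ x y : A.space,
    (φ ⟨x.1 * y.1, A.mul_mem x.2 y.2⟩ : ℂ[H]) = (φ x : ℂ[H]) * (φ y : ℂ[H])
  map_hadamard : ∀ x y : A.space,
    (φ ⟨hadamardProd x.1 y.1, A.hadamard_mem x.2 y.2⟩ : ℂ[H]) =
      hadamardProd (φ x : ℂ[H]) (φ y : ℂ[H])

end

end SupercharacterTheory

end

/-! The algebra of a supercharacter theory has two distinguished bases. The superclass sums are the
primitive idempotents of the Hadamard product; the elements `E_X = |G|⁻¹ ∑_g σ_X(g) g` are the
primitive idempotents of the ordinary product. Each product is coordinatewise in its own basis, and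
the matrix between the two bases is the supercharacter table divided by `|G|`.

An isomorphism permutes primitive idempotents, so it matches both bases and hence the two tables up
to the factor `|H|/|G|`. This factor is `1`: the trivial row of ones in the table of `A` goes to a
constant row, and a constant row can only be the trivial one (`eq_one_of_table_eq_const`).

Conversely, equal tables give `|G| = |H|`, since the order is the only nonzero column sum
(`sum_table`). Then the linear map matching superclass sums also matches the `E_X`, so it respects
both products. -/

/-! ### Linear maps and coordinatewise products -/

section CoordinatewiseProducts

open Module

variable {ι κ V W : Type*} [AddCommGroup V] [Module ℂ V] [AddCommGroup W] [Module ℂ W]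

/-- A multiplicative bijective linear map between spaces whose products are coordinatewise with
respect to the bases `b` and `b'` carries `b` to `b'`, up to reindexing. -/
theorem exists_equiv_of_coordinatewise_mul [Finite ι] [Finite κ] (b : Basis ι ℂ V)
    (b' : Basis κ ℂ W) (m : V → V → V) (m' : W → W → W)
    (hm : ∀ x y i, b.repr (m x y) i = b.repr x i * b.repr y i)
    (hm' : ∀ x y i, b'.repr (m' x y) i = b'.repr x i * b'.repr y i)
    (φ : V →ₗ[ℂ] W) (hφ : ∀ x y, φ (m x y) = m' (φ x) (φ y)) (hbij : Function.Bijective φ) :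
    ∃ e : ι ≃ κ, ∀ i, φ (b i) = b' (e i) := by
  classical
  cases nonempty_fintype ι
  cases nonempty_fintype κ
  have hb : ∀ i j, m (b i) (b j) = if i = j then b i else 0 := by
    intro i j
    refine b.ext_elem fun k => ?_
    rw [hm]
    by_cases hij : i = j
    · subst hij
      simp [Finsupp.single_apply]
    · rw [if_neg hij]
      by_cases hik : i = k
      · subst hik
        simp [Ne.symm hij]
      · simp [Finsupp.single_apply, hik]
  have hcoord : ∀ i j k, b'.repr (φ (b i)) k * b'.repr (φ (b j)) k =
      if i = j then b'.repr (φ (b i)) k else 0 := by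
    intro i j k
    rw [← hm', ← hφ, hb]
    split_ifs <;> simp
  -- The coordinates of the idempotent `φ (b i)` satisfy `t * t = t`, so they are `0` or `1`; if
  -- none were `1`, injectivity of `φ` would fail.
  have hex : ∀ i, ∃ k, b'.repr (φ (b i)) k = 1 := by
    intro i
    by_contra! hne
    refine b.ne_zero i (hbij.1 ?_)
    rw [map_zero]
    refine b'.ext_elem fun k => ?_
    have := hcoord i i k
    rw [if_pos rfl] at this
    rw [map_zero, Finsupp.zero_apply]
    by_contra h0
    exact hne k (mul_left_cancel₀ h0 (this.trans (mul_one _).symm))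
  choose σ hσ using hex
  have hzero : ∀ i j, i ≠ j → b'.repr (φ (b i)) (σ j) = 0 := by
    intro i j hij
    simpa [hσ, hij] using hcoord i j (σ j)
  have hinj : Function.Injective σ := by
    intro i j hij
    by_contra hne
    have := hzero i j hne
    rw [← hij, hσ] at this
    exact one_ne_zero this
  -- Equal dimensions make `σ` onto, so `hσ` and `hzero` account for every coordinate of `φ (b i)`.
  have hcard : Fintype.card ι = Fintype.card κ := by
    rw [← finrank_eq_card_basis b, ← finrank_eq_card_basis b']
    exact (LinearEquiv.ofBijective φ hbij).finrank_eq
  have hσbij : Function.Bijective σ := (Fintype.bijective_iff_injective_and_card σ).2 ⟨hinj, hcard⟩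
  refine ⟨Equiv.ofBijective σ hσbij, fun i => b'.ext_elem fun k => ?_⟩
  obtain ⟨j, rfl⟩ := hσbij.2 k
  rw [Equiv.ofBijective_apply, b'.repr_self, Finsupp.single_apply]
  by_cases hij : i = j
  · subst hij
    simp [hσ]
  · rw [hzero i j hij, if_neg fun h => hij (hinj h)]

theorem repr_basis_equiv_apply (b : Basis ι ℂ V) (b' : Basis κ ℂ W) (e : ι ≃ κ) (x : V) (i : ι) :
    b'.repr (b.equiv b' e x) (e i) = b.repr x i := by
  have h : (b'.coord (e i)).comp (b.equiv b' e).toLinearMap = b.coord i := b.ext fun j => by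
    classical simp [Finsupp.single_apply]
  exact LinearMap.congr_fun h x

theorem basis_equiv_coordinatewise_mul (b : Basis ι ℂ V)
    (b' : Basis κ ℂ W) (m : V → V → V) (m' : W → W → W)
    (hm : ∀ x y i, b.repr (m x y) i = b.repr x i * b.repr y i)
    (hm' : ∀ x y i, b'.repr (m' x y) i = b'.repr x i * b'.repr y i) (e : ι ≃ κ) (x y : V) :
    b.equiv b' e (m x y) = m' (b.equiv b' e x) (b.equiv b' e y) := by
  refine b'.ext_elem fun k => ?_
  obtain ⟨i, rfl⟩ := e.surjective k
  simp only [hm', repr_basis_equiv_apply, hm]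

end CoordinatewiseProducts

/-! ### The two bases of idempotents -/

namespace SupercharacterTheory

open Module

variable {G : Type u} [Group G] [Finite G] (A : SupercharacterTheory G)

open Classical in
theorem coeff_setSum_of_mem {K : Set G} (hK : K ∈ A.superclasses) (L : A.superclasses) {g : G}
    (hg : g ∈ K) : (setSum L.1).coeff g = if L.1 = K then 1 else 0 := by
  rw [coeff_setSum]
  refine if_congr ⟨fun h => ?_, fun h => h ▸ hg⟩ rfl rfl
  exact (A.isPartition_superclasses.2 g).unique ⟨L.2, h⟩ ⟨hK, hg⟩

theorem linearIndependent_setSum :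
    LinearIndependent ℂ fun K : A.superclasses => setSum K.1 := by
  classical
  rw [linearIndependent_iff']
  intro s a hs K hK
  obtain ⟨g, hg⟩ := A.nonempty_superclass K
  have := congrArg (fun x => x.coeff g) hs
  simpa [MonoidAlgebra.coeff_sum, Finsupp.finsetSum_apply, A.coeff_setSum_of_mem K.2 _ hg,
    ← Subtype.ext_iff, hK] using this

/-- The basis of superclass sums. -/
noncomputable def classBasis : Basis A.superclasses ℂ A.space :=
  Basis.span A.linearIndependent_setSum

theorem coe_classBasis (K : A.superclasses) : (A.classBasis K : ℂ[G]) = setSum K.1 :=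
  congrArg Subtype.val (Basis.span_apply A.linearIndependent_setSum K)

theorem classBasis_repr (x : A.space) (K : A.superclasses) {g : G} (hg : g ∈ K.1) :
    A.classBasis.repr x K = x.1.coeff g := by
  classical
  cases nonempty_fintype A.superclasses
  conv_rhs => rw [← A.classBasis.sum_repr x]
  simp [-Basis.sum_repr, MonoidAlgebra.coeff_sum, Finsupp.finsetSum_apply, coe_classBasis,
    A.coeff_setSum_of_mem K.2 _ hg, ← Subtype.ext_iff]

open Classical in
/-- The basis of primitive idempotents for the ordinary product. -/
noncomputable def blockBasis : Basis A.charBlocks ℂ A.space :=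
  (Basis.span (linearIndependent_of_orthogonal A.blockElt A.blockElt_mul A.blockElt_ne_zero)).map
    (LinearEquiv.ofEq _ _ A.span_blockElt)

theorem coe_blockBasis (X : A.charBlocks) : (A.blockBasis X : ℂ[G]) = A.blockElt X := by
  rw [blockBasis, Basis.map_apply, LinearEquiv.coe_ofEq_apply, Basis.span_apply]

/-- Orthogonality of the idempotents lets multiplication by one of them isolate a single coordinate.
-/
theorem blockElt_mul_coe (x : A.space) (X : A.charBlocks) :
    A.blockElt X * (x : ℂ[G]) = A.blockBasis.repr x X • A.blockElt X := by
  classical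
  cases nonempty_fintype A.charBlocks
  conv_lhs => rw [← A.blockBasis.sum_repr x]
  simp [-Basis.sum_repr, coe_blockBasis, Finset.mul_sum, blockElt_mul]

/-- The ordinary product on the algebra of a supercharacter theory. -/
noncomputable def spaceMul (x y : A.space) : A.space := ⟨x.1 * y.1, A.mul_mem x.2 y.2⟩

/-- The Hadamard product on the algebra of a supercharacter theory. -/
noncomputable def spaceHadamard (x y : A.space) : A.space := ⟨hadamardProd x.1 y.1, A.hadamard_mem x.2 y.2⟩

theorem classBasis_repr_spaceHadamard (x y : A.space) (K : A.superclasses) :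
    A.classBasis.repr (A.spaceHadamard x y) K =
      A.classBasis.repr x K * A.classBasis.repr y K := by
  obtain ⟨g, hg⟩ := A.nonempty_superclass K
  simp only [A.classBasis_repr _ K hg, spaceHadamard, coeff_hadamardProd]

theorem blockBasis_repr_spaceMul (x y : A.space) (X : A.charBlocks) :
    A.blockBasis.repr (A.spaceMul x y) X = A.blockBasis.repr x X * A.blockBasis.repr y X := by
  have h := A.blockElt_mul_coe (A.spaceMul x y) X
  rw [spaceMul, ← mul_assoc, blockElt_mul_coe, smul_mul_assoc, blockElt_mul_coe, smul_smul] at h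
  exact (smul_left_injective ℂ (A.blockElt_ne_zero X) h).symm

theorem coeff_blockElt (X : A.charBlocks) (g : G) :
    (A.blockElt X).coeff g = (Nat.card G : ℂ)⁻¹ * sigmaChar X.1 g := by
  simp only [blockElt, sigmaChar, MonoidAlgebra.coeff_sum, Finsupp.finsetSum_apply, irrElt,
    MonoidAlgebra.coeff_smul_apply, coeff_funToAlg, Finset.mul_sum, smul_eq_mul]
  exact Finset.sum_congr rfl fun χ _ => by ring

/-- The bridge between the algebra and the table: the table is the change-of-basis matrix, up to the
group order. -/
theorem classBasis_repr_blockBasis (X : A.charBlocks) (K : A.superclasses) :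
    A.classBasis.repr (A.blockBasis X) K = (Nat.card G : ℂ)⁻¹ * A.table X K := by
  obtain ⟨g, hg⟩ := A.nonempty_superclass K
  rw [A.classBasis_repr _ K hg, coe_blockBasis, coeff_blockElt, A.table_eq X K hg]

/-! ### Column sums and constant rows -/

theorem one_mem_space : (1 : ℂ[G]) ∈ A.space := by
  classical
  have : (1 : ℂ[G]) = setSum {1} := by
    ext g
    simp [coeff_setSum, MonoidAlgebra.one_def, Finsupp.single_apply, eq_comm]
  rw [this]
  exact Submodule.subset_span ⟨⟨_, A.one_mem⟩, rfl⟩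

/-- Multiplying `1` by an idempotent returns that idempotent, so every coordinate of `1` in the
block basis is `1`. -/
theorem sum_blockElt [Fintype A.charBlocks] : ∑ X, A.blockElt X = 1 := by
  have h1 : ∀ X, A.blockBasis.repr ⟨1, A.one_mem_space⟩ X = 1 := fun X => by
    have h := A.blockElt_mul_coe ⟨1, A.one_mem_space⟩ X
    rw [mul_one] at h
    refine (smul_left_injective ℂ (A.blockElt_ne_zero X) ?_).symm
    simpa using h
  have h := congrArg Subtype.val (A.blockBasis.sum_repr ⟨1, A.one_mem_space⟩)
  simpa [h1, coe_blockBasis] using h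

open Classical in
/-- The sum of a column of the supercharacter table. -/
theorem sum_table [Fintype A.charBlocks] (K : A.superclasses) :
    ∑ X, A.table X K = if K.1 = {1} then (Nat.card G : ℂ) else 0 := by
  have hcard : (Nat.card G : ℂ) ≠ 0 := by exact_mod_cast Nat.card_pos.ne'
  obtain ⟨g, hg⟩ := A.nonempty_superclass K
  -- The coefficient at `g` of `∑ X, E_X = 1` is the column sum divided by `|G|`.
  have h := congrArg (fun x => x.coeff g) A.sum_blockElt
  simp only [MonoidAlgebra.coeff_sum, Finsupp.finsetSum_apply, coeff_blockElt, ← Finset.mul_sum,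
    ← A.table_eq _ K hg] at h
  rw [inv_mul_eq_iff_eq_mul₀ hcard] at h
  rw [h, MonoidAlgebra.one_def, MonoidAlgebra.coeff_single, Finsupp.single_apply]
  have : 1 = g ↔ K.1 = {1} := by
    constructor
    · rintro rfl
      exact (A.isPartition_superclasses.2 1).unique ⟨K.2, hg⟩ ⟨A.one_mem, rfl⟩
    · intro hK
      rw [hK] at hg
      exact hg.symm
  simp [this]

theorem table_trivIrr (K : A.superclasses) : A.table ⟨_, A.triv_mem⟩ K = 1 := by
  simp [table, sigmaChar, trivIrr]

/-- A constant row of the supercharacter table is the row of the trivial character. -/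
theorem eq_one_of_table_eq_const (X : A.charBlocks) (a : ℂ) (h : ∀ K, A.table X K = a) :
    a = 1 := by
  have hcard : (Nat.card G : ℂ) ≠ 0 := by exact_mod_cast Nat.card_pos.ne'
  -- A constant row makes `E_X` proportional to the idempotent of the trivial block; independence
  -- then forces `X` to be that block.
  have hX : A.blockBasis X = a • A.blockBasis ⟨_, A.triv_mem⟩ := by
    refine A.classBasis.ext_elem fun K => ?_
    rw [classBasis_repr_blockBasis, h, map_smul, Finsupp.smul_apply, classBasis_repr_blockBasis,
      table_trivIrr, smul_eq_mul]
    ring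
  have h2 := congrArg (fun x => A.blockBasis.repr x X) hX
  by_cases hXt : X = ⟨_, A.triv_mem⟩
  · rw [← hXt] at h2
    simpa using h2.symm
  · simp [Ne.symm hXt] at h2

end SupercharacterTheory

/-- The bijection `c` is not assumed to send `{1}` to `{1}`. Still, the column of `{1}` sums to `|G|
≠ 0`, so its image must be the one column of `B` with nonzero sum, which is `|H|`. -/
theorem SupercharacterTheory.card_eq_of_table_eq {G : Type u} {H : Type v} [Group G] [Finite G]
    [Group H] [Finite H] {A : SupercharacterTheory G} {B : SupercharacterTheory H}
    (r : A.charBlocks ≃ B.charBlocks) (c : A.superclasses ≃ B.superclasses)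
    (h : ∀ X K, A.table X K = B.table (r X) (c K)) : Nat.card G = Nat.card H := by
  classical
  cases nonempty_fintype A.charBlocks
  cases nonempty_fintype B.charBlocks
  have hsum : ∑ X, A.table X ⟨_, A.one_mem⟩ = ∑ Y, B.table Y (c ⟨_, A.one_mem⟩) :=
    Fintype.sum_equiv r _ _ fun X => h X _
  rw [A.sum_table, B.sum_table, if_pos rfl] at hsum
  split_ifs at hsum
  · exact_mod_cast hsum
  · exact absurd (Nat.cast_eq_zero.1 hsum) Nat.card_pos.ne'

/-! ### Isomorphisms and equality of tables -/

theorem mainTheorem2 {G : Type u} {H : Type v} [Group G] [Finite G] [Group H] [Finite H]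
    (A : SupercharacterTheory G) (B : SupercharacterTheory H) :
    (∃ φ : A.space →ₗ[ℂ] B.space, A.IsHom B φ ∧ Function.Bijective φ) ↔
      ∃ (r : A.charBlocks ≃ B.charBlocks) (c : A.superclasses ≃ B.superclasses),
        ∀ X K, A.table X K = B.table (r X) (c K) := by
  have hG : (Nat.card G : ℂ) ≠ 0 := by exact_mod_cast Nat.card_pos.ne'
  have hH : (Nat.card H : ℂ) ≠ 0 := by exact_mod_cast Nat.card_pos.ne'
  constructor
  · rintro ⟨φ, hφ, hbij⟩
    obtain ⟨r, hr⟩ := exists_equiv_of_coordinatewise_mul A.blockBasis B.blockBasis A.spaceMul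
      B.spaceMul A.blockBasis_repr_spaceMul B.blockBasis_repr_spaceMul φ
      (fun x y => Subtype.ext (hφ.map_mul x y)) hbij
    obtain ⟨c, hc⟩ := exists_equiv_of_coordinatewise_mul A.classBasis B.classBasis A.spaceHadamard
      B.spaceHadamard A.classBasis_repr_spaceHadamard B.classBasis_repr_spaceHadamard φ
      (fun x y => Subtype.ext (hφ.map_hadamard x y)) hbij
    -- Hence `φ` preserves coordinates in the class bases, in particular those of the `E_X`, which
    -- are the scaled table entries.
    have hφc : φ = A.classBasis.equiv B.classBasis c := A.classBasis.ext fun K => by simp [hc]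
    have htable : ∀ X K, (Nat.card G : ℂ)⁻¹ * A.table X K =
        (Nat.card H : ℂ)⁻¹ * B.table (r X) (c K) := by
      intro X K
      rw [← A.classBasis_repr_blockBasis, ← B.classBasis_repr_blockBasis, ← hr, hφc]
      exact (repr_basis_equiv_apply _ _ c _ K).symm
    -- By `htable`, the row of `B` matched with the trivial row of `A` is constant, equal to
    -- `|H|/|G|`.
    have hcard : (Nat.card H : ℂ) * (Nat.card G : ℂ)⁻¹ = 1 := by
      refine B.eq_one_of_table_eq_const (r ⟨_, A.triv_mem⟩) _ fun L => ?_
      obtain ⟨K, rfl⟩ := c.surjective L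
      have := htable ⟨_, A.triv_mem⟩ K
      rw [A.table_trivIrr, mul_one] at this
      rw [this, mul_inv_cancel_left₀ hH]
    have hcard : (Nat.card H : ℂ) = Nat.card G := by
      rwa [← div_eq_mul_inv, div_eq_one_iff_eq hG] at hcard
    refine ⟨r, c, fun X K => mul_left_cancel₀ (inv_ne_zero hG) ?_⟩
    rw [htable, hcard]
  · rintro ⟨r, c, h⟩
    have hcard := SupercharacterTheory.card_eq_of_table_eq r c h
    -- Both maps send `E_X` to `E_(r X)`: the class coordinates of these elements are table entries
    -- over `|G| = |H|`. One description of the map yields the Hadamard product, the other the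
    -- ordinary product.
    have heq : A.classBasis.equiv B.classBasis c = A.blockBasis.equiv B.blockBasis r := by
      refine A.blockBasis.ext' fun X => B.classBasis.ext_elem fun L => ?_
      obtain ⟨K, rfl⟩ := c.surjective L
      rw [repr_basis_equiv_apply, Module.Basis.equiv_apply, A.classBasis_repr_blockBasis,
        B.classBasis_repr_blockBasis, h, hcard]
    refine ⟨(A.classBasis.equiv B.classBasis c).toLinearMap, ⟨fun x y => ?_, fun x y => ?_⟩,
      (A.classBasis.equiv B.classBasis c).bijective⟩
    · rw [heq]
      exact congrArg Subtype.val (basis_equiv_coordinatewise_mul A.blockBasis B.blockBasis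
        A.spaceMul B.spaceMul A.blockBasis_repr_spaceMul B.blockBasis_repr_spaceMul r x y)
    · exact congrArg Subtype.val (basis_equiv_coordinatewise_mul A.classBasis B.classBasis
        A.spaceHadamard B.spaceHadamard A.classBasis_repr_spaceHadamard
        B.classBasis_repr_spaceHadamard c x y)
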